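/- Let $\mathcal N$ be a quantum channel between finite-dimensional systems, i.e. a completely positive trace-preserving linear map from the operators on a nonzero finite-dimensional complex Hilbert space $\mathcal H_A$ to the operators on a finite-dimensional complex Hilbert space $\mathcal H_B$. Let $$\mathrm{CE}_{\max}(\mathcal N)=\sup_{\rho\neq\rho'}\frac{\|\mathcal N(\rho)-\mathcal N(\rho')\|_1}{\|\rho-\rho'\|_1},$$ the supremum over all pairs of distinct density matrices on $\mathcal H_A$ (and $0$ if $\dim\mathcal H_A=1$), where $\|X\|_1=\operatorname{Tr}\sqrt{X^*X}$ is the trace norm. Let $C(\mathcal N)$ be the classical capacity of $\mathcal N$: the supremum of all real $R$ such that for all $\varepsilon,\delta>0$ and all sufficiently large $n$ there are an integer $M\ge 2^{n(R-\delta)}$, density matrices $\rho_1,\dots,\rho_M$ on $\mathcal H_A^{\otimes n}$ and a measurement $(E_m)_{m=1}^M$ on $\mathcal H_B^{\otimes n}$ ($E_m\ge 0$, $\sum_m E_m=I$) with $\operatorname{Tr}[E_m\,\mathcal N^{\otimes n}(\rho_m)]\ge 1-\varepsilon$ for every $m$. Then $$C(\mathcal N)\ \ge\ 1-h_2\!\left(\frac{1-\mathrm{CE}_{\max}(\mathcal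 N)}{2}\right),$$ where $h_2(x)=-x\log_2 x-(1-x)\log_2(1-x)$, with $0\log_2 0=0$, is the binary entropy. Moreover, if $\dim\mathcal H_A\ge 2$, the bound comes from a single use of the channel with two orthogonal inputs: there are orthonormal vectors $\psi_0,\psi_1\in\mathcal H_A$ and a two-outcome measurement $(E_0,E_1)$ on $\mathcal H_B$ such that the mutual information $I(X;Y)$, in bits, of a uniformly distributed bit $X$ and the bit $Y$ with $P(Y=y\mid X=x)=\operatorname{Tr}[E_y\,\mathcal N(|\psi_x\rangle\langle\psi_x|)]$ satisfies $$C(\mathcal N)\ \ge\ I(X;Y)\ \ge\ 1-h_2\!\left(\frac{1-\mathrm{CE}_{\max}(\mathcal N)}{2}\right).$$ -/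

import Mathlib

noncomputable section

namespace QuantumCapacity

open scoped ComplexOrder

/-- Density matrices: the states of the quantum system with Hilbert space `ℂ^a`. -/
def IsState {a : Type*} [Fintype a] (ρ : Matrix a a ℂ) : Prop :=
  ρ.PosSemidef ∧ ρ.trace = 1

/-- A positive-operator-valued measure on `ℂ^b` with outcomes in `ι`. -/
structure POVM (ι b : Type*) [Fintype ι] [Fintype b] [DecidableEq b] where
  effect : ι → Matrix b b ℂ
  posSemidef : ∀ i, (effect i).PosSemidef
  sum_eq_one : ∑ i, effect i = 1

/-- The map `id_k ⊗ Φ` on `k × k` block matrices: `Φ` is applied to every block. -/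
def ampliation {a b : Type*} (k : ℕ) (Φ : Matrix a a ℂ →ₗ[ℂ] Matrix b b ℂ)
    (X : Matrix (Fin k × a) (Fin k × a) ℂ) : Matrix (Fin k × b) (Fin k × b) ℂ :=
  Matrix.of fun p q => Φ (Matrix.of fun x x' => X (p.1, x) (q.1, x')) p.2 q.2

/-- A quantum channel: a completely positive trace-preserving linear map from the operators on
`ℂ^a` to the operators on `ℂ^b`. -/
structure QuantumChannel (a b : Type*) [Fintype a] [Fintype b] where
  toLinearMap : Matrix a a ℂ →ₗ[ℂ] Matrix b b ℂ
  completelyPositive : ∀ (k : ℕ) (X : Matrix (Fin k × a) (Fin k × a) ℂ),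
    X.PosSemidef → (ampliation k toLinearMap X).PosSemidef
  trace_preserving : ∀ X : Matrix a a ℂ, (toLinearMap X).trace = X.trace

section TraceNorm

open scoped MatrixOrder

/-- The trace norm `‖X‖₁ = Tr |X|` with `|X| = √(X* X)`; for Hermitian `X` one has
`|X| = X₊ + X₋`, with `X₊` and `X₋` the positive and negative parts. -/
def traceNorm {b : Type*} [Fintype b] [DecidableEq b] (X : Matrix b b ℂ) : ℝ :=
  (CFC.abs X).trace.re

end TraceNorm

/-- The binary entropy in bits, with the convention `0 log 0 = 0`. -/
def binaryEntropy (x : ℝ) : ℝ :=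
  -x * Real.logb 2 x - (1 - x) * Real.logb 2 (1 - x)

/-- The mutual information, in bits, of a uniformly distributed input bit and the output bit of
the classical channel with transition probabilities `P x y = P(y | x)`. -/
def uniformMutualInfo (P : Fin 2 → Fin 2 → ℝ) : ℝ :=
  ∑ x, ∑ y, (1 / 2) * P x y * Real.logb 2 (P x y / ∑ x', (1 / 2) * P x' y)

/-- The rank-one projection `|ψ⟩⟨ψ|` (for a unit vector `ψ`, a pure state). -/
def pureState {a : Type*} (ψ : EuclideanSpace ℂ a) : Matrix a a ℂ :=
  Matrix.of fun x x' => ψ x * star (ψ x')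

namespace QuantumChannel

variable {a b : Type*} [Fintype a] [Fintype b]

/-- The maximum causal effect: the supremum of `‖N ρ - N ρ'‖₁ / ‖ρ - ρ'‖₁` over all pairs of
distinct input states. These ratios lie in `[0, 1]`; if the input is one-dimensional, there is no
such pair and the value is `0`. -/
def maxCausalEffect [DecidableEq a] [DecidableEq b] (N : QuantumChannel a b) : ℝ :=
  sSup {r : ℝ | ∃ ρ ρ' : Matrix a a ℂ, IsState ρ ∧ IsState ρ' ∧ ρ ≠ ρ' ∧
    r = traceNorm (N.toLinearMap ρ - N.toLinearMap ρ') / traceNorm (ρ - ρ')}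

/-- The `n`-fold tensor power `N^{⊗ n}`. The Hilbert space `(ℂ^a)^{⊗ n}` is `ℂ^(Fin n → a)`, and
`N^{⊗ n}` maps each matrix unit `|x⟩⟨x'| = ⨂ᵢ |xᵢ⟩⟨x'ᵢ|` to `⨂ᵢ N(|xᵢ⟩⟨x'ᵢ|)`. -/
def tensorPower [DecidableEq a] (N : QuantumChannel a b) (n : ℕ)
    (X : Matrix (Fin n → a) (Fin n → a) ℂ) : Matrix (Fin n → b) (Fin n → b) ℂ :=
  Matrix.of fun y y' => ∑ x : Fin n → a, ∑ x' : Fin n → a,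
    X x x' * ∏ i, N.toLinearMap (Matrix.single (x i) (x' i) 1) (y i) (y' i)

end QuantumChannel

/-- A classical code with `M` messages for `n` uses of a channel from `ℂ^a` to `ℂ^b`: arbitrary
(possibly entangled) codeword states of the `n` inputs and an arbitrary joint measurement of the
`n` outputs. -/
structure ClassicalCode (a b : Type*) [Fintype a] [Fintype b] [DecidableEq b] (n M : ℕ) where
  encoder : Fin M → Matrix (Fin n → a) (Fin n → a) ℂ
  encoder_isState : ∀ m, IsState (encoder m)
  decoder : POVM (Fin M) (Fin n → b)

namespace QuantumChannel

variable {a b : Type*} [Fintype a] [DecidableEq a] [Fintype b] [DecidableEq b]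

/-- The probability that message `m` is decoded incorrectly. -/
def errorProb (N : QuantumChannel a b) {n M : ℕ} (c : ClassicalCode a b n M) (m : Fin M) : ℝ :=
  1 - (c.decoder.effect m * N.tensorPower n (c.encoder m)).trace.re

/-- `R` bits per channel use is an achievable rate of reliable classical communication: for all
`ε, δ > 0` and all large enough `n` there is a code for `n` uses with at least `2^(n (R - δ))`
messages, each of which is decoded with error probability at most `ε`. -/
def IsAchievableRate (N : QuantumChannel a b) (R : ℝ) : Prop :=
  ∀ ε > (0 : ℝ), ∀ δ > (0 : ℝ), ∃ n₀ : ℕ, ∀ n ≥ n₀, ∃ (M : ℕ) (c : ClassicalCode a b n M),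
    (2 : ℝ) ^ ((n : ℝ) * (R - δ)) ≤ (M : ℝ) ∧ ∀ m, N.errorProb c m ≤ ε

/-- The classical capacity: the supremum of the achievable rates, taken in the extended reals. -/
def classicalCapacity (N : QuantumChannel a b) : EReal :=
  sSup {c : EReal | ∃ R : ℝ, N.IsAchievableRate R ∧ c = (R : EReal)}

/-- The probability of outcome `y` when the pure state `ψ x` is sent through one use of `N` and
the output is measured with `E`. -/
def singleUseProb (N : QuantumChannel a b) (ψ : Fin 2 → EuclideanSpace ℂ a)
    (E : POVM (Fin 2) b) (x y : Fin 2) : ℝ :=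
  (E.effect y * N.toLinearMap (pureState (ψ x))).trace.re

end QuantumChannel

end QuantumCapacity

end

/-! The bound comes from the best binary experiment on one use of N. Let 2s be the maximum of Tr[S
N(φφ*)] - Tr[S N(χχ*)] over orthonormal φ, χ and reflections S; compactness attains it
(`exists_maximizer`).

Then CE_max ≤ s. The trace norm of N(ρ - ρ') equals Tr[S N(ρ - ρ')] for some reflection S. In an
eigenbasis of ρ - ρ' this pairs the eigenvalues, which sum to zero, with numbers of oscillation at
most 2s, so it is at most s‖ρ - ρ'‖₁ (`expectation_trace_le`, `maxCausalEffect_le`).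

Measuring (1 ± S)/2 on the optimal pair gives a binary channel with average error (1 - s)/2.
Concavity of entropy yields I(X;Y) ≥ 1 - h₂((1 - s)/2), and h₂ increases on [0, 1/2], so s may be
replaced by CE_max.

Finally C(N) ≥ I(X;Y): Shannon's theorem (`exists_code_of_lt_mutualInfo`, by Feinstein's greedy
construction and Chebyshev's inequality) codes for the induced classical channel, and product states
with product measurements realise that code. -/

namespace QuantumCapacity

/-! ### Feinstein's construction and Chebyshev's inequality -/

open Finset

/-- Greedy code construction (Feinstein): codewords `c m` together with a decoding map `dec`, for
messages `m < M`, such that message `m` is only decoded inside the region `A (c m)`. -/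
theorem exists_greedy_code {X Y : Type*} [Fintype X] [Fintype Y] (P : X → ℝ) (W : X → Y → ℝ)
    (hP : ∀ x, 0 ≤ P x) (hP1 : ∑ x, P x = 1) (hW : ∀ x y, 0 ≤ W x y) (hW1 : ∀ x, ∑ y, W x y = 1)
    (A : X → Y → Prop) [∀ x, DecidablePred (A x)] (T : ℝ) (hT : 0 < T)
    (hA : ∀ x y, A x y → T * ∑ x', P x' * W x' y ≤ W x y) (ε : ℝ) (M : ℕ)
    (hM : ((M : ℝ) - 1) / T + ∑ x, P x * ∑ y, (if A x y then 0 else W x y) < ε) :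
    ∃ (c : ℕ → X) (dec : Y → ℕ), ∀ m < M, (∀ y, dec y = m → A (c m) y) ∧
      1 - ε ≤ ∑ y, if dec y = m then W (c m) y else 0 := by
  have : Nonempty X := by
    by_contra h
    rw [not_nonempty_iff] at h
    simp at hP1
  induction M with
  | zero => exact ⟨fun _ => Classical.arbitrary X, fun _ => 0, by simp⟩
  | succ M ih =>
    obtain ⟨c, dec, h⟩ := ih (lt_of_le_of_lt (by gcongr; simp) hM)
    -- If no codeword fits, the unclaimed part of `A` has average mass at most 1 - ε. The claimed
    -- outputs have mass at most M / T, as `W` dominates T times the output law on `A`. With the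
    -- mass outside `A` these cover 1, against `hM`.
    have key : ∃ x, 1 - ε ≤ ∑ y, if dec y < M then 0 else if A x y then W x y else 0 := by
      by_contra! hcon
      have h1 : ∑ x, P x * ∑ y, (if dec y < M then 0 else if A x y then W x y else 0)
          ≤ 1 - ε := by
        calc _ ≤ ∑ x, P x * (1 - ε) := by
              gcongr with x
              · exact hP x
              · exact (hcon x).le
          _ = 1 - ε := by rw [← Finset.sum_mul, hP1, one_mul]
      have h2 : ∑ x, P x * ∑ y, (if dec y < M then W x y else 0) ≤ M / T := by
        have : ∑ x, P x * ∑ y, (if dec y < M then W x y else 0) =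
            ∑ m ∈ range M, ∑ y, if dec y = m then ∑ x, P x * W x y else 0 := by
          rw [Finset.sum_comm]
          simp_rw [Finset.mul_sum]
          rw [Finset.sum_comm]
          refine Finset.sum_congr rfl fun y _ => ?_
          rw [Finset.sum_ite_eq]
          by_cases hy : dec y < M <;> simp [hy]
        rw [this, div_eq_mul_one_div, ← nsmul_eq_mul, ← Finset.card_range M]
        nth_rewrite 1 [Finset.card_range]
        refine Finset.sum_le_card_nsmul _ _ _ fun m hm => ?_
        rw [le_div_iff₀' hT, Finset.mul_sum, ← hW1 (c m)]
        refine Finset.sum_le_sum fun y _ => ?_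
        split_ifs with hy
        · exact hA _ _ ((h m (Finset.mem_range.1 hm)).1 y hy)
        · simpa using hW _ _
      have h3 : ∑ x, P x * ∑ y, (if dec y < M then 0 else if A x y then W x y else 0)
          + ∑ x, P x * ∑ y, (if dec y < M then W x y else 0)
          + ∑ x, P x * ∑ y, (if A x y then 0 else W x y) ≥ 1 := by
        rw [← Finset.sum_add_distrib, ← Finset.sum_add_distrib, ← hP1]
        refine Finset.sum_le_sum fun x _ => ?_
        rw [← mul_add, ← mul_add, ← Finset.sum_add_distrib, ← Finset.sum_add_distrib]
        refine le_mul_of_one_le_right (hP x) ?_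
        rw [← hW1 x]
        refine Finset.sum_le_sum fun y _ => ?_
        have := hW x y
        split_ifs <;> linarith
      push_cast at hM
      rw [add_sub_cancel_right] at hM
      linarith
    obtain ⟨x, hx⟩ := key
    -- The value M + 1 means "unclaimed": it is not below M + 1, so the next round may still take
    -- the output.
    refine ⟨Function.update c M x,
      fun y => if dec y < M then dec y else if A x y then M else M + 1, fun m hm => ?_⟩
    rcases Nat.lt_succ_iff_lt_or_eq.1 hm with hm | rfl
    · rw [Function.update_of_ne hm.ne]
      refine ⟨fun y hy => (h m hm).1 y ?_, (h m hm).2.trans (Finset.sum_le_sum fun y _ => ?_)⟩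
      · dsimp only at hy
        split_ifs at hy <;> omega
      · by_cases hy : dec y = m
        · simp [hy, hm]
        · simp only [hy, if_false]
          split_ifs <;> first | exact le_rfl | exact hW _ _
    · rw [Function.update_self]
      refine ⟨fun y hy => ?_, hx.trans (Finset.sum_le_sum fun y _ => ?_)⟩
      · dsimp only at hy
        split_ifs at hy with h1 h2
        · omega
        · exact h2
        · omega
      · by_cases h1 : dec y < m
        · simp only [h1, if_true, h1.ne, if_false, le_rfl]
        · by_cases h2 : A x y <;> simp [h1, h2]

theorem sum_prod_fin {Z : Type*} [Fintype Z] (f : Z → ℝ) (n : ℕ) :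
    ∑ z : Fin n → Z, ∏ i, f (z i) = (∑ z, f z) ^ n := by
  rw [← Fin.prod_const, Finset.prod_univ_sum, Fintype.piFinset_univ]

/-- The variance of a sum of independent centred random variables is additive. -/
theorem sum_prod_mul_sq {Z : Type*} [Fintype Z] (p ℓ : Z → ℝ) (hp : ∑ z, p z = 1)
    (hℓ : ∑ z, p z * ℓ z = 0) (n : ℕ) :
    ∑ z : Fin n → Z, (∏ i, p (z i)) * ∑ i, ℓ (z i) = 0 ∧
    ∑ z : Fin n → Z, (∏ i, p (z i)) * (∑ i, ℓ (z i)) ^ 2 = n * ∑ z, p z * ℓ z ^ 2 := by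
  -- The vanishing first moment is carried along because it kills the cross term of the square.
  induction n with
  | zero => simp
  | succ n ih =>
    have e (f : (Fin (n + 1) → Z) → ℝ) :
        ∑ z, f z = ∑ z₀ : Z, ∑ z : Fin n → Z, f (Fin.cons z₀ z) := by
      rw [← (Fin.consEquiv fun _ => Z).sum_comp, Fintype.sum_prod_type]
      rfl
    have h1 : ∑ z : Fin n → Z, ∏ i, p (z i) = 1 := by rw [sum_prod_fin, hp, one_pow]
    rw [e, e]
    simp only [Fin.prod_univ_succ, Fin.sum_univ_succ, Fin.cons_zero, Fin.cons_succ]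
    constructor
    · calc _ = ∑ z₀, ((p z₀ * ℓ z₀) * ∑ z : Fin n → Z, ∏ i, p (z i)
            + p z₀ * ∑ z : Fin n → Z, (∏ i, p (z i)) * ∑ i, ℓ (z i)) := by
            refine Finset.sum_congr rfl fun z₀ _ => ?_
            rw [Finset.mul_sum, Finset.mul_sum, ← Finset.sum_add_distrib]
            exact Finset.sum_congr rfl fun z _ => by ring
        _ = 0 := by simp [h1, ih.1, hℓ]
    · calc _ = ∑ z₀, ((p z₀ * ℓ z₀ ^ 2) * ∑ z : Fin n → Z, ∏ i, p (z i)
            + 2 * (p z₀ * ℓ z₀) * ∑ z : Fin n → Z, (∏ i, p (z i)) * ∑ i, ℓ (z i)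
            + p z₀ * ∑ z : Fin n → Z, (∏ i, p (z i)) * (∑ i, ℓ (z i)) ^ 2) := by
            refine Finset.sum_congr rfl fun z₀ _ => ?_
            rw [Finset.mul_sum, Finset.mul_sum, Finset.mul_sum, ← Finset.sum_add_distrib,
              ← Finset.sum_add_distrib]
            exact Finset.sum_congr rfl fun z _ => by ring
        _ = _ := by
            simp only [h1, ih.1, ih.2, mul_one, mul_zero, add_zero]
            rw [Finset.sum_add_distrib, ← Finset.sum_mul, hp]
            push_cast
            ring

/-- Chebyshev's inequality for the empirical mean of `n` independent samples. -/
theorem sum_prod_deviation_le {Z : Type*} [Fintype Z] (p ℓ : Z → ℝ) (hp0 : ∀ z, 0 ≤ p z)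
    (hp : ∑ z, p z = 1) (hℓ : ∑ z, p z * ℓ z = 0) {n : ℕ} (hn : 0 < n) {t : ℝ} (ht : 0 < t) :
    ∑ z : Fin n → Z, (if -(n * t) < ∑ i, ℓ (z i) then 0 else ∏ i, p (z i))
      ≤ (∑ z, p z * ℓ z ^ 2) / t ^ 2 / n := by
  have hn' : (0 : ℝ) < n := by exact_mod_cast hn
  rw [div_div, le_div_iff₀ (by positivity), ← mul_le_mul_iff_right₀ hn']
  rw [← (sum_prod_mul_sq p ℓ hp hℓ n).2, mul_comm, Finset.sum_mul, Finset.sum_mul]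
  refine Finset.sum_le_sum fun z _ => ?_
  have hz : 0 ≤ ∏ i, p (z i) := Finset.prod_nonneg fun i _ => hp0 _
  split_ifs with h
  · simp only [zero_mul]
    positivity
  · have h2 : (n * t) ^ 2 ≤ (∑ i, ℓ (z i)) ^ 2 := by
      rw [← neg_sq (∑ i, ℓ (z i))]
      have : 0 < n * t := by positivity
      gcongr
      linarith
    calc _ = (∏ i, p (z i)) * (n * t) ^ 2 := by ring
      _ ≤ _ := by gcongr

end QuantumCapacity

/-! ### Shannon's coding theorem, direct part -/

namespace QuantumCapacity

open Finset

/-- Direct part of Shannon's noisy-channel coding theorem with maximal error probability: every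
rate below the mutual information of the input distribution `P` is achieved. -/
theorem exists_code_of_lt_mutualInfo {X Y : Type*} [Fintype X] [Fintype Y] (P : X → ℝ)
    (W : X → Y → ℝ) (hP : ∀ x, 0 ≤ P x) (hP1 : ∑ x, P x = 1) (hW : ∀ x y, 0 ≤ W x y)
    (hW1 : ∀ x, ∑ y, W x y = 1) {I : ℝ}
    (hI : I = ∑ x, ∑ y, P x * W x y * Real.logb 2 (W x y / ∑ x', P x' * W x' y))
    {ε δ : ℝ} (hε : 0 < ε) (hδ : 0 < δ) :
    ∃ n₀ : ℕ, ∀ n ≥ n₀, ∃ (M : ℕ) (c : Fin M → Fin n → X) (dec : (Fin n → Y) → Fin M),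
      (2 : ℝ) ^ ((n : ℝ) * (I - δ)) ≤ M ∧
      ∀ m, 1 - ε ≤ ∑ y, if dec y = m then ∏ i, W (c m i) (y i) else 0 := by
  classical
  set Q : Y → ℝ := fun y => ∑ x', P x' * W x' y
  let p : X × Y → ℝ := fun z => P z.1 * W z.1 z.2
  let ℓ : X × Y → ℝ := fun z => Real.logb 2 (W z.1 z.2 / Q z.2) - I
  have hp0 : ∀ z, 0 ≤ p z := fun z => mul_nonneg (hP _) (hW _ _)
  have hp1 : ∑ z, p z = 1 := by
    simp only [p, Fintype.sum_prod_type, ← Finset.mul_sum, hW1, mul_one, hP1]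
  have hℓ : ∑ z, p z * ℓ z = 0 := by
    simp only [ℓ, mul_sub, Finset.sum_sub_distrib]
    rw [← Finset.sum_mul, hp1, one_mul, hI, Fintype.sum_prod_type, sub_self]
  set V := (∑ z, p z * ℓ z ^ 2) / (δ / 2) ^ 2
  have ev1 : ∀ᶠ n : ℕ in Filter.atTop, V / n < ε / 2 :=
    (tendsto_const_div_atTop_nhds_zero_nat V).eventually_lt_const (by positivity)
  have ev2 : ∀ᶠ n : ℕ in Filter.atTop, ((2 : ℝ) ^ (-(δ / 2))) ^ n < ε / 2 :=
    (tendsto_pow_atTop_nhds_zero_of_lt_one (by positivity)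
      (Real.rpow_lt_one_of_one_lt_of_neg one_lt_two (by linarith))).eventually_lt_const
      (by positivity)
  obtain ⟨n₀, hn₀⟩ := Filter.eventually_atTop.1
    ((ev1.and ev2).and (Filter.eventually_gt_atTop 0))
  refine ⟨n₀, fun n hn => ?_⟩
  obtain ⟨⟨hn1, hn2⟩, hn0⟩ := hn₀ n hn
  set M := ⌈(2 : ℝ) ^ ((n : ℝ) * (I - δ))⌉₊
  have hM0 : 0 < M := Nat.ceil_pos.2 (by positivity)
  have hM1 : (M : ℝ) - 1 < (2 : ℝ) ^ ((n : ℝ) * (I - δ)) := by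
    linarith [Nat.ceil_lt_add_one (a := (2 : ℝ) ^ ((n : ℝ) * (I - δ))) (by positivity)]
  -- The threshold rate I - δ/2 lies halfway between the code rate and I: (M - 1) / T is below
  -- 2^(-nδ/2), and information density below the threshold has probability at most V / n.
  set T := (2 : ℝ) ^ ((n : ℝ) * (I - δ / 2)) with hT
  have hT0 : 0 < T := by positivity
  let A : (Fin n → X) → (Fin n → Y) → Prop := fun x y =>
    T * ∏ i, Q (y i) ≤ ∏ i, W (x i) (y i)
  have hprod (y : Fin n → Y) :
      ∑ x : Fin n → X, (∏ i, P (x i)) * ∏ i, W (x i) (y i) = ∏ i, Q (y i) := by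
    simp_rw [← Finset.prod_mul_distrib]
    rw [Finset.prod_univ_sum, Fintype.piFinset_univ]
  have hbad : ∑ x : Fin n → X, (∏ i, P (x i)) *
      ∑ y, (if A x y then 0 else ∏ i, W (x i) (y i)) ≤ V / n := by
    refine le_trans (le_of_eq ?_) ((Finset.sum_le_sum (f := fun z : Fin n → X × Y =>
      if A (fun i => (z i).1) (fun i => (z i).2) then 0 else ∏ i, p (z i)) fun z _ => ?_).trans
      (sum_prod_deviation_le p ℓ hp0 hp1 hℓ hn0 (half_pos hδ)))
    · rw [← (Equiv.arrowProdEquivProdArrow (Fin n) (fun _ => X) (fun _ => Y)).symm.sum_comp,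
        Fintype.sum_prod_type]
      refine Finset.sum_congr rfl fun x _ => ?_
      rw [Finset.mul_sum]
      refine Finset.sum_congr rfl fun y _ => ?_
      simp only [p, Equiv.arrowProdEquivProdArrow, Equiv.coe_fn_symm_mk, mul_ite, mul_zero,
        Finset.prod_mul_distrib]
    · have hz : 0 ≤ ∏ i, p (z i) := Finset.prod_nonneg fun i _ => hp0 _
      split_ifs with h1 h2 h2
      · exact le_rfl
      · exact hz
      -- Sequences of probability zero contribute nothing. On the others all `W` and `Q` factors are
      -- positive, and logarithms turn the deviation bound into membership in `A`.
      · by_contra hne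
        have hpos : ∀ i, 0 < p (z i) := fun i => by
          refine lt_of_le_of_ne (hp0 _) fun h0 => hne ?_
          rw [Finset.prod_eq_zero (Finset.mem_univ i) h0.symm]
        have hWpos : ∀ i, 0 < W (z i).1 (z i).2 := fun i =>
          lt_of_le_of_ne (hW _ _) fun h0 => (hpos i).ne' (by simp [p, ← h0])
        have hQpos : ∀ i, 0 < Q (z i).2 := fun i => (hpos i).trans_le
          (Finset.single_le_sum (f := fun x => P x * W x (z i).2)
            (fun x _ => mul_nonneg (hP _) (hW _ _)) (Finset.mem_univ (z i).1))
        refine h1 ?_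
        change T * ∏ i, Q (z i).2 ≤ ∏ i, W (z i).1 (z i).2
        have hQQ : 0 < ∏ i, Q (z i).2 := Finset.prod_pos fun i _ => hQpos i
        rw [← le_div_iff₀ hQQ, ← Finset.prod_div_distrib, hT, ← Real.le_logb_iff_rpow_le one_lt_two
          (Finset.prod_pos fun i _ => div_pos (hWpos i) (hQpos i)),
          Real.logb_prod _ _ (fun i _ => (div_pos (hWpos i) (hQpos i)).ne')]
        simp only [ℓ, Finset.sum_sub_distrib, Finset.sum_const, Finset.card_univ,
          Fintype.card_fin, nsmul_eq_mul] at h2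
        linarith
      · exact le_rfl
  obtain ⟨c, dec, h⟩ := exists_greedy_code (fun x : Fin n → X => ∏ i, P (x i))
    (fun x (y : Fin n → Y) => ∏ i, W (x i) (y i)) (fun x => Finset.prod_nonneg fun i _ => hP _)
    (by rw [sum_prod_fin, hP1, one_pow]) (fun x y => Finset.prod_nonneg fun i _ => hW _ _)
    (fun x => by
      have := Finset.prod_univ_sum (fun _ => (Finset.univ : Finset Y)) fun i y => W (x i) y
      rw [Fintype.piFinset_univ] at this
      rw [← this]
      simp [hW1])
    A T hT0 (fun x y hxy => by rw [hprod]; exact hxy) ε M (by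
      have : ((M : ℝ) - 1) / T < ε / 2 := by
        refine lt_of_le_of_lt ?_ hn2
        rw [div_le_iff₀ hT0, hT, ← Real.rpow_natCast, ← Real.rpow_mul (by norm_num),
          ← Real.rpow_add (by norm_num)]
        refine hM1.le.trans (le_of_eq ?_)
        ring_nf
      linarith)
  -- Unclaimed outputs go to message 0, which can only raise success probabilities.
  refine ⟨M, fun m => c m, fun y => if hy : dec y < M then ⟨dec y, hy⟩ else ⟨0, hM0⟩,
    Nat.le_ceil _, fun m => (h m m.2).2.trans (Finset.sum_le_sum fun y _ => ?_)⟩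
  have hpr : 0 ≤ ∏ i, W (c m i) (y i) := Finset.prod_nonneg fun i _ => hW _ _
  by_cases hy : dec y = m
  · simp [hy]
  · simp only [hy, if_false]
    split_ifs <;> first | exact le_rfl | exact hpr

end QuantumCapacity

/-! ### Product states, product measurements and achievable rates -/

namespace QuantumCapacity

open scoped ComplexOrder
open Finset Matrix

/-- The tensor product `⨂ᵢ A i` of `n` matrices. -/
def tensorMatrix {b : Type*} {n : ℕ} (A : Fin n → Matrix b b ℂ) :
    Matrix (Fin n → b) (Fin n → b) ℂ :=
  Matrix.of fun y y' => ∏ i, A i (y i) (y' i)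

section Tensor

variable {b : Type*} {n : ℕ}

theorem sum_prod_apply [Fintype b] (f : Fin n → b → ℂ) : ∑ y : Fin n → b, ∏ i, f i (y i) = ∏ i, ∑ u, f i u := by
  rw [Finset.prod_univ_sum, Fintype.piFinset_univ]

theorem tensorMatrix_mul [Fintype b] (A B : Fin n → Matrix b b ℂ) :
    tensorMatrix A * tensorMatrix B = tensorMatrix fun i => A i * B i := by
  ext y y'
  simp only [tensorMatrix, Matrix.mul_apply, Matrix.of_apply, ← Finset.prod_mul_distrib]
  exact sum_prod_apply fun i u => A i (y i) u * B i u (y' i)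

theorem trace_tensorMatrix [Fintype b] (A : Fin n → Matrix b b ℂ) :
    (tensorMatrix A).trace = ∏ i, (A i).trace := by
  simp only [Matrix.trace, Matrix.diag, tensorMatrix, Matrix.of_apply]
  exact sum_prod_apply fun i u => A i u u

theorem sum_tensorMatrix {ι : Type*} [Fintype ι] (A : Fin n → ι → Matrix b b ℂ) :
    ∑ y : Fin n → ι, tensorMatrix (fun i => A i (y i)) = tensorMatrix fun i => ∑ k, A i k := by
  ext u u'
  simp only [tensorMatrix, Matrix.sum_apply, Matrix.of_apply]
  exact sum_prod_apply fun i k => A i k (u i) (u' i)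

theorem tensorMatrix_one [DecidableEq b] :
    tensorMatrix (fun _ : Fin n => (1 : Matrix b b ℂ)) = 1 := by
  ext u u'
  simp only [tensorMatrix, Matrix.of_apply, Matrix.one_apply]
  rw [Finset.prod_ite_zero]
  simp [funext_iff]

-- Factor each A i as B* B; the tensor product respects products and adjoints.
open scoped MatrixOrder in
theorem posSemidef_tensorMatrix [Fintype b] [DecidableEq b] {A : Fin n → Matrix b b ℂ}
    (hA : ∀ i, (A i).PosSemidef) : (tensorMatrix A).PosSemidef := by
  have h : ∀ i, ∃ B : Matrix b b ℂ, A i = Bᴴ * B := fun i =>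
    CStarAlgebra.nonneg_iff_eq_star_mul_self.1 (hA i).nonneg
  choose B hB using h
  have : tensorMatrix A = (tensorMatrix B)ᴴ * tensorMatrix B := by
    have : (tensorMatrix B)ᴴ = tensorMatrix fun i => (B i)ᴴ := by
      ext u u'
      simp [tensorMatrix]
    rw [this, tensorMatrix_mul]
    congr 1
    exact funext hB
  rw [this]
  exact Matrix.posSemidef_conjTranspose_mul_self _

open scoped MatrixOrder in
theorem trace_mul_nonneg [Fintype b] [DecidableEq b] {A B : Matrix b b ℂ} (hA : A.PosSemidef)
    (hB : B.PosSemidef) : 0 ≤ (A * B).trace := by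
  obtain ⟨C, hC⟩ := CStarAlgebra.nonneg_iff_eq_star_mul_self.1 hA.nonneg
  rw [hC, mul_assoc, Matrix.trace_mul_comm]
  exact (hB.mul_mul_conjTranspose_same C).trace_nonneg

end Tensor

theorem posSemidef_pureState {a : Type*} [Fintype a] (ψ : EuclideanSpace ℂ a) :
    (pureState ψ).PosSemidef :=
  Matrix.posSemidef_vecMulVec_self_star ψ

theorem isState_pureState {a : Type*} [Fintype a] {ψ : EuclideanSpace ℂ a} (h : ‖ψ‖ = 1) :
    IsState (pureState ψ) := by
  refine ⟨posSemidef_pureState ψ, ?_⟩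
  have h2 : ∑ i, ‖ψ i‖ ^ 2 = 1 := by rw [← EuclideanSpace.norm_sq_eq, h, one_pow]
  simp only [Matrix.trace, Matrix.diag, pureState, Matrix.of_apply]
  rw [← Complex.ofReal_one, ← h2, Complex.ofReal_sum]
  refine Finset.sum_congr rfl fun i _ => ?_
  rw [← starRingEnd_apply, Complex.mul_conj, Complex.normSq_eq_norm_sq]

namespace QuantumChannel

variable {a b : Type*} [Fintype a] [Fintype b]

/-- This is complete positivity at k = 1, with `a` identified with `Fin 1 × a`. -/
theorem posSemidef_map (N : QuantumChannel a b) {X : Matrix a a ℂ} (hX : X.PosSemidef) :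
    (N.toLinearMap X).PosSemidef :=
  (N.completelyPositive 1 (X.submatrix Prod.snd Prod.snd) (hX.submatrix _)).submatrix
    fun y => ((0 : Fin 1), y)

/-- Expanding every factor in matrix units, the sums over words factor into sums over letters. -/
theorem tensorPower_tensorMatrix [DecidableEq a] (N : QuantumChannel a b) {n : ℕ} (ρ : Fin n → Matrix a a ℂ) :
    N.tensorPower n (tensorMatrix ρ) = tensorMatrix fun i => N.toLinearMap (ρ i) := by
  have hN (X : Matrix a a ℂ) (y y' : b) : N.toLinearMap X y y' =
      ∑ x, ∑ x', X x x' * N.toLinearMap (Matrix.single x x' 1) y y' := by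
    conv_lhs => rw [Matrix.matrix_eq_sum_single X]
    simp only [map_sum, Matrix.sum_apply]
    refine Finset.sum_congr rfl fun x _ => Finset.sum_congr rfl fun x' _ => ?_
    have h : Matrix.single x x' (X x x') = X x x' • Matrix.single x x' (1 : ℂ) := by
      rw [Matrix.smul_single, smul_eq_mul, mul_one]
    rw [h, map_smul, Matrix.smul_apply, smul_eq_mul]
  ext y y'
  simp only [tensorPower, tensorMatrix, Matrix.of_apply, ← Finset.prod_mul_distrib]
  have h1 (x : Fin n → a) := sum_prod_apply fun i x' =>
    ρ i (x i) x' * N.toLinearMap (Matrix.single (x i) x' 1) (y i) (y' i)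
  simp only [h1]
  rw [sum_prod_apply fun i x => ∑ x', ρ i x x' * N.toLinearMap (Matrix.single x x' 1) (y i) (y' i)]
  simp only [← hN]

theorem ofReal_singleUseProb [DecidableEq b] (N : QuantumChannel a b) (ψ : Fin 2 → EuclideanSpace ℂ a)
    (E : POVM (Fin 2) b) (x y : Fin 2) :
    (N.singleUseProb ψ E x y : ℂ) = (E.effect y * N.toLinearMap (pureState (ψ x))).trace := by
  have h := trace_mul_nonneg (E.posSemidef y) (N.posSemidef_map (posSemidef_pureState (ψ x)))
  exact (Complex.eq_re_of_ofReal_le (r := 0) (by simpa using h)).symm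

theorem singleUseProb_nonneg [DecidableEq b] (N : QuantumChannel a b) (ψ : Fin 2 → EuclideanSpace ℂ a)
    (E : POVM (Fin 2) b) (x y : Fin 2) : 0 ≤ N.singleUseProb ψ E x y :=
  (Complex.le_def.1 (trace_mul_nonneg (E.posSemidef y)
    (N.posSemidef_map (posSemidef_pureState (ψ x))))).1

theorem sum_singleUseProb [DecidableEq b] (N : QuantumChannel a b) {ψ : Fin 2 → EuclideanSpace ℂ a}
    (hψ : ∀ x, ‖ψ x‖ = 1) (E : POVM (Fin 2) b) (x : Fin 2) :
    ∑ y, N.singleUseProb ψ E x y = 1 := by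
  simp only [singleUseProb]
  rw [← Complex.re_sum, ← Matrix.trace_sum, ← Finset.sum_mul, E.sum_eq_one, one_mul,
    N.trace_preserving, (isState_pureState (hψ x)).2, Complex.one_re]

/-- Product codewords and a product measurement turn classical codes into quantum ones. -/
theorem isAchievableRate_uniformMutualInfo [DecidableEq a] [DecidableEq b]
    (N : QuantumChannel a b)
    {ψ : Fin 2 → EuclideanSpace ℂ a} (hψ : ∀ x, ‖ψ x‖ = 1) (E : POVM (Fin 2) b) :
    N.IsAchievableRate (uniformMutualInfo (N.singleUseProb ψ E)) := by
  intro ε hε δ hδ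
  obtain ⟨n₀, h⟩ := exists_code_of_lt_mutualInfo (fun _ : Fin 2 => (1 / 2 : ℝ))
    (N.singleUseProb ψ E) (fun _ => by norm_num) (by norm_num) (N.singleUseProb_nonneg ψ E)
    (N.sum_singleUseProb hψ E) (I := uniformMutualInfo (N.singleUseProb ψ E)) rfl hε hδ
  refine ⟨n₀, fun n hn => ?_⟩
  obtain ⟨M, c, dec, hM, hc⟩ := h n hn
  refine ⟨M,
    { encoder := fun m => tensorMatrix fun i => pureState (ψ (c m i))
      encoder_isState := fun m => ⟨posSemidef_tensorMatrix fun i => posSemidef_pureState _, by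
        rw [trace_tensorMatrix]
        exact Finset.prod_eq_one fun i _ => (isState_pureState (hψ _)).2⟩
      decoder :=
      { effect := fun m => ∑ y : Fin n → Fin 2,
          if dec y = m then tensorMatrix (fun i => E.effect (y i)) else 0
        posSemidef := fun m => Matrix.posSemidef_sum _ fun y _ => by
          split_ifs
          · exact posSemidef_tensorMatrix fun i => E.posSemidef _
          · exact Matrix.PosSemidef.zero
        sum_eq_one := by
          rw [Finset.sum_comm]
          simp only [Finset.sum_ite_eq, Finset.mem_univ, if_true]
          rw [sum_tensorMatrix fun _ => E.effect, E.sum_eq_one, tensorMatrix_one] } },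
    hM, fun m => ?_⟩
  refine (sub_le_comm.1 (hc m)).trans' (le_of_eq ?_)
  simp only [errorProb]
  rw [tensorPower_tensorMatrix, Finset.sum_mul, Matrix.trace_sum, Complex.re_sum]
  congr 1
  refine Finset.sum_congr rfl fun y _ => ?_
  split_ifs
  · rw [tensorMatrix_mul, trace_tensorMatrix]
    simp only [← ofReal_singleUseProb]
    rw [← Complex.ofReal_prod, Complex.ofReal_re]
  · simp

theorem uniformMutualInfo_le_classicalCapacity [DecidableEq a] [DecidableEq b]
    (N : QuantumChannel a b)
    {ψ : Fin 2 → EuclideanSpace ℂ a} (hψ : ∀ x, ‖ψ x‖ = 1) (E : POVM (Fin 2) b) :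
    (uniformMutualInfo (N.singleUseProb ψ E) : EReal) ≤ N.classicalCapacity :=
  le_sSup ⟨_, N.isAchievableRate_uniformMutualInfo hψ E, rfl⟩

end QuantumChannel

end QuantumCapacity

/-! ### Entropy inequalities for a binary channel -/

namespace QuantumCapacity

open Finset

theorem binaryEntropy_eq_binEntropy_div (x : ℝ) :
    binaryEntropy x = Real.binEntropy x / Real.log 2 := by
  simp only [binaryEntropy, Real.binEntropy, Real.logb, Real.log_inv]
  ring

/-- For one output with likelihoods u, v under the two inputs, this is its share of the mutual
information in nats: its probability times one bit minus the posterior entropy. -/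
theorem pair_information_eq {u v : ℝ} (hu : 0 ≤ u) (hv : 0 ≤ v) :
    u / 2 * Real.log (u / ((u + v) / 2)) + v / 2 * Real.log (v / ((u + v) / 2)) =
      (u + v) / 2 * (Real.log 2 - Real.binEntropy (v / (u + v))) := by
  rcases hu.eq_or_lt with rfl | hu
  · rcases hv.eq_or_lt with rfl | hv
    · simp
    · have : v / (v / 2) = 2 := by field_simp
      simp [this, div_self hv.ne']
  rcases hv.eq_or_lt with rfl | hv
  · have : u / (u / 2) = 2 := by field_simp
    simp [this]
  have huv : u + v ≠ 0 := by positivity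
  have h1 : 1 - v / (u + v) = u / (u + v) := by field_simp; ring
  rw [Real.binEntropy, h1, Real.log_inv, Real.log_inv, Real.log_div hu.ne' (by positivity),
    Real.log_div hv.ne' (by positivity), Real.log_div huv two_ne_zero,
    Real.log_div hv.ne' huv, Real.log_div hu.ne' huv]
  field_simp
  ring

/-- Fano's inequality for a uniform bit observed through a binary channel with error probability
`(1 - s) / 2`. -/
theorem one_sub_binaryEntropy_le_uniformMutualInfo {P : Fin 2 → Fin 2 → ℝ}
    (hP : ∀ x y, 0 ≤ P x y) (hP1 : ∀ x, ∑ y, P x y = 1) :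
    1 - binaryEntropy ((1 - (P 0 0 - P 1 0)) / 2) ≤ uniformMutualInfo P := by
  have h0 := hP1 0
  have h1 := hP1 1
  simp only [Fin.sum_univ_two] at h0 h1
  have hl : 0 < Real.log 2 := Real.log_pos one_lt_two
  have key : ∀ {u v : ℝ}, 0 ≤ u → 0 ≤ v → v / (u + v) ∈ Set.Icc (0 : ℝ) 1 ∧
      (u + v) / 2 * (v / (u + v)) = v / 2 := fun {u v} hu hv => by
    refine ⟨⟨by positivity, div_le_one_of_le₀ (by linarith) (by positivity)⟩, ?_⟩
    rcases eq_or_ne (u + v) 0 with h | h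
    · have : v = 0 := by linarith
      simp [this]
    · field_simp
  obtain ⟨ha, ha'⟩ := key (hP 0 0) (hP 1 0)
  obtain ⟨hb, hb'⟩ := key (hP 1 1) (hP 0 1)
  -- Jensen for the posterior error probabilities, weighted by the output probabilities; their mean
  -- is the average error.
  have hconc := Real.strictConcave_binEntropy.concaveOn.2 ha hb
    (show 0 ≤ (P 0 0 + P 1 0) / 2 by linarith [hP 0 0, hP 1 0])
    (show 0 ≤ (P 1 1 + P 0 1) / 2 by linarith [hP 1 1, hP 0 1]) (by linarith)
  simp only [smul_eq_mul] at hconc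
  rw [ha', hb', show P 1 0 / 2 + P 0 1 / 2 = (1 - (P 0 0 - P 1 0)) / 2 by linarith] at hconc
  have hI : uniformMutualInfo P * Real.log 2 =
      (P 0 0 / 2 * Real.log (P 0 0 / ((P 0 0 + P 1 0) / 2)) +
        P 1 0 / 2 * Real.log (P 1 0 / ((P 0 0 + P 1 0) / 2))) +
      (P 1 1 / 2 * Real.log (P 1 1 / ((P 1 1 + P 0 1) / 2)) +
        P 0 1 / 2 * Real.log (P 0 1 / ((P 1 1 + P 0 1) / 2))) := by
    have e1 : 1 / 2 * P 0 0 + 1 / 2 * P 1 0 = (P 0 0 + P 1 0) / 2 := by ring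
    have e2 : 1 / 2 * P 0 1 + 1 / 2 * P 1 1 = (P 1 1 + P 0 1) / 2 := by ring
    simp only [uniformMutualInfo, Fin.sum_univ_two, Real.logb]
    rw [e1, e2]
    field_simp
    ring
  rw [pair_information_eq (hP 0 0) (hP 1 0), pair_information_eq (hP 1 1) (hP 0 1)] at hI
  rw [binaryEntropy_eq_binEntropy_div, ← mul_le_mul_iff_left₀ hl, sub_mul, div_mul_cancel₀ _ hl.ne',
    hI]
  have h2 : (P 0 0 + P 1 0) / 2 + (P 1 1 + P 0 1) / 2 = 1 := by linarith
  linear_combination hconc - Real.log 2 * h2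

theorem binaryEntropy_anti {c s : ℝ} (hc : 0 ≤ c) (hcs : c ≤ s) (hs : s ≤ 1) :
    binaryEntropy ((1 - s) / 2) ≤ binaryEntropy ((1 - c) / 2) := by
  rw [binaryEntropy_eq_binEntropy_div, binaryEntropy_eq_binEntropy_div]
  refine div_le_div_of_nonneg_right ?_ (Real.log_pos one_lt_two).le
  exact Real.binEntropy_strictMonoOn.monotoneOn ⟨by linarith, by linarith⟩
    ⟨by linarith, by linarith⟩ (by linarith)

/-- Pairing a vector of sum zero with a function of oscillation at most `2 s`. -/
theorem sum_mul_le_mul_sum_abs {ι : Type*} [Fintype ι] (w g : ι → ℝ) {s : ℝ}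
    (hw : ∑ i, w i = 0) (hg : ∀ i j, g i - g j ≤ 2 * s) : ∑ i, w i * g i ≤ s * ∑ i, |w i| := by
  rcases isEmpty_or_nonempty ι with h | h
  · simp
  obtain ⟨i, hi⟩ := Finite.exists_max g
  obtain ⟨j, hj⟩ := Finite.exists_min g
  -- Subtracting the midrange of `g` is free since `w` sums to zero, and leaves values in [-s, s].
  have e : ∑ k, w k * g k = ∑ k, w k * (g k - (g i + g j) / 2) := by
    simp only [mul_sub, Finset.sum_sub_distrib, ← Finset.sum_mul, hw, zero_mul, sub_zero]
  rw [e, Finset.mul_sum]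
  refine Finset.sum_le_sum fun k _ => (le_abs_self _).trans ?_
  rw [abs_mul, mul_comm]
  refine mul_le_mul_of_nonneg_right (abs_le.2 ⟨?_, ?_⟩) (abs_nonneg _) <;>
    linarith [hi k, hj k, hg i j]

end QuantumCapacity

/-! ### Trace norm, reflections and optimal orthogonal inputs -/

namespace QuantumCapacity

open Finset Matrix
open scoped ComplexOrder

section Spectral

variable {a : Type*} [Fintype a] [DecidableEq a]

open scoped MatrixOrder in
theorem traceNorm_nonneg (X : Matrix a a ℂ) : 0 ≤ traceNorm X :=
  (Complex.le_def.1 (CFC.abs_nonneg X).posSemidef.trace_nonneg).1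

open scoped MatrixOrder in
theorem traceNorm_eq_trace_cfc {X : Matrix a a ℂ} (hX : X.IsHermitian) :
    traceNorm X = (hX.cfc fun t => |t|).trace.re := by
  rw [traceNorm, CFC.abs_eq_cfc_norm X, hX.cfc_eq]
  rfl

theorem traceNorm_eq_sum_abs_eigenvalues {X : Matrix a a ℂ} (hX : X.IsHermitian) :
    traceNorm X = ∑ i, |hX.eigenvalues i| := by
  rw [traceNorm_eq_trace_cfc hX, Matrix.IsHermitian.cfc, Unitary.conjStarAlgAut_apply,
    Matrix.trace_mul_cycle, Unitary.coe_star_mul_self, one_mul, Matrix.trace_diagonal]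
  simp

/-- The trace norm of a Hermitian matrix is attained at a reflection. -/
theorem exists_reflection_trace_eq_traceNorm {X : Matrix a a ℂ} (hX : X.IsHermitian) :
    ∃ S : Matrix a a ℂ, Sᴴ = S ∧ S * S = 1 ∧ (S * X).trace.re = traceNorm X := by
  -- The sign of each eigenvalue, with zero sent to 1 so that the square is the identity.
  let d : a → ℂ := fun i => if 0 ≤ hX.eigenvalues i then 1 else -1
  let u := Unitary.conjStarAlgAut ℂ (Matrix a a ℂ) hX.eigenvectorUnitary
  refine ⟨u (Matrix.diagonal d), ?_, ?_, ?_⟩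
  · rw [← Matrix.star_eq_conjTranspose, ← map_star, Matrix.star_eq_conjTranspose,
      Matrix.diagonal_conjTranspose]
    congr 2
    funext i
    simp only [d, Pi.star_apply]
    split_ifs <;> simp
  · rw [← map_mul, Matrix.diagonal_mul_diagonal]
    have : (fun i => d i * d i) = fun _ => 1 := by
      funext i
      simp only [d]
      split_ifs <;> simp
    rw [this, Matrix.diagonal_one, map_one]
  · rw [traceNorm_eq_trace_cfc hX]
    conv_lhs => rw [hX.spectral_theorem]
    rw [Matrix.IsHermitian.cfc]
    change (u _ * u _).trace.re = (u _).trace.re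
    rw [← map_mul, Matrix.diagonal_mul_diagonal]
    congr 4
    funext i
    simp only [d, Function.comp_apply]
    split_ifs with h
    · simp [abs_of_nonneg h]
    · simp [abs_of_neg (not_le.1 h)]

theorem eq_sum_smul_pureState {X : Matrix a a ℂ} (hX : X.IsHermitian) :
    X = ∑ i, (hX.eigenvalues i : ℂ) • pureState (hX.eigenvectorBasis i) := by
  conv_lhs => rw [hX.spectral_theorem, Unitary.conjStarAlgAut_apply]
  ext x x'
  rw [Matrix.mul_apply, Matrix.sum_apply]
  refine Finset.sum_congr rfl fun i _ => ?_
  rw [Matrix.mul_diagonal, Matrix.smul_apply, pureState, Matrix.of_apply, Matrix.star_apply]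
  simp only [Matrix.IsHermitian.eigenvectorUnitary_apply, Function.comp_apply, smul_eq_mul]
  simp only [Complex.coe_algebraMap]
  ring

end Spectral

/-- The two-outcome measurement `((1 + S) / 2, (1 - S) / 2)` of a reflection `S`. -/
noncomputable def reflectionPOVM {b : Type*} [Fintype b] [DecidableEq b] (S : Matrix b b ℂ) (hS : Sᴴ = S)
    (hS1 : S * S = 1) : POVM (Fin 2) b where
  effect := ![(1 / 2 : ℂ) • (1 + S), (1 / 2 : ℂ) • (1 - S)]
  posSemidef := by
    have key : ∀ R : Matrix b b ℂ, Rᴴ = R → R * R = 1 → ((1 / 2 : ℂ) • (1 + R)).PosSemidef := by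
      intro R hR hR1
      -- (1 + R)/2 is a self-adjoint projection.
      have : (1 / 2 : ℂ) • (1 + R) = ((1 / 2 : ℂ) • (1 + R))ᴴ * ((1 / 2 : ℂ) • (1 + R)) := by
        rw [Matrix.conjTranspose_smul, Matrix.conjTranspose_add, hR, Matrix.conjTranspose_one,
          Matrix.smul_mul, Matrix.mul_smul, smul_smul, add_mul, mul_add, mul_add, hR1, one_mul,
          mul_one, one_mul]
        rw [show 1 + R + (R + 1) = (2 : ℂ) • (1 + R) by rw [two_smul]; abel, smul_smul]
        congr 1
        simp
      rw [this]
      exact Matrix.posSemidef_conjTranspose_mul_self _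
    intro i
    fin_cases i
    · exact key S hS hS1
    · simpa [sub_eq_add_neg] using key (-S) (by simp [hS]) (by simp [hS1])
  sum_eq_one := by
    simp only [Fin.sum_univ_two, Matrix.cons_val_zero, Matrix.cons_val_one]
    rw [← smul_add, add_add_sub_cancel, ← two_smul ℂ (1 : Matrix b b ℂ), smul_smul]
    norm_num

/-- A Hermitian involution is unitary, so its entries are bounded by 1. -/
theorem isCompact_reflections {b : Type*} [Fintype b] [DecidableEq b] :
    IsCompact {S : Matrix b b ℂ | Sᴴ = S ∧ S * S = 1} := by
  have hB : IsCompact {S : Matrix b b ℂ | ∀ i j, S i j ∈ Metric.closedBall (0 : ℂ) 1} := by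
    have := isCompact_univ_pi fun _ : b => isCompact_univ_pi fun _ : b =>
      isCompact_closedBall (0 : ℂ) 1
    simp only [Set.pi, Set.mem_univ, forall_true_left] at this
    exact this
  refine hB.of_isClosed_subset ?_ ?_
  · exact (isClosed_eq continuous_id.matrix_conjTranspose continuous_id).inter
      (isClosed_eq (continuous_id.matrix_mul continuous_id) continuous_const)
  · rintro S ⟨h1, h2⟩ i j
    have hS : S ∈ Matrix.unitaryGroup b ℂ := by
      rw [Matrix.mem_unitaryGroup_iff, Matrix.star_eq_conjTranspose, h1, h2]
    simpa using entry_norm_bound_of_unitary hS i j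

theorem isCompact_orthonormal_pairs {a : Type*} [Fintype a] :
    IsCompact {z : EuclideanSpace ℂ a × EuclideanSpace ℂ a |
      ‖z.1‖ = 1 ∧ ‖z.2‖ = 1 ∧ inner ℂ z.1 z.2 = 0} := by
  refine ((isCompact_closedBall (0 : EuclideanSpace ℂ a) 1).prod
    (isCompact_closedBall (0 : EuclideanSpace ℂ a) 1)).of_isClosed_subset ?_ ?_
  · exact (isClosed_eq (by fun_prop) continuous_const).inter
      ((isClosed_eq (by fun_prop) continuous_const).inter
      (isClosed_eq (by fun_prop) continuous_const))
  · rintro ⟨φ, χ⟩ ⟨h1, h2, -⟩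
    exact ⟨by simpa using h1.le, by simpa using h2.le⟩

namespace QuantumChannel

variable {a b : Type*} [Fintype a] [Fintype b]

/-- The expectation of the observable `S` after sending the pure state `ψ` through `N`. -/
noncomputable def expectation (N : QuantumChannel a b) (S : Matrix b b ℂ) (ψ : EuclideanSpace ℂ a) : ℝ :=
  (S * N.toLinearMap (pureState ψ)).trace.re

/-- Reduces arbitrary pairs of states to orthogonal pure ones: distinct vectors of an eigenbasis of
X are orthonormal, so `h` bounds the oscillation of their expectations. -/
theorem expectation_trace_le [DecidableEq a] (N : QuantumChannel a b) (S : Matrix b b ℂ) {s : ℝ}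
    (hs : 0 ≤ s) (h : ∀ φ χ : EuclideanSpace ℂ a, ‖φ‖ = 1 → ‖χ‖ = 1 → inner ℂ φ χ = 0 →
      N.expectation S φ - N.expectation S χ ≤ 2 * s)
    {X : Matrix a a ℂ} (hX : X.IsHermitian) (hX0 : X.trace = 0) :
    (S * N.toLinearMap X).trace.re ≤ s * traceNorm X := by
  rw [traceNorm_eq_sum_abs_eigenvalues hX]
  have e : (S * N.toLinearMap X).trace.re =
      ∑ i, hX.eigenvalues i * N.expectation S (hX.eigenvectorBasis i) := by
    conv_lhs => rw [eq_sum_smul_pureState hX]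
    rw [map_sum, Finset.mul_sum, Matrix.trace_sum, Complex.re_sum]
    refine Finset.sum_congr rfl fun i _ => ?_
    rw [map_smul, Matrix.mul_smul, Matrix.trace_smul, smul_eq_mul, Complex.re_ofReal_mul]
    rfl
  rw [e]
  refine sum_mul_le_mul_sum_abs _ _ ?_ fun i j => ?_
  · have := hX.trace_eq_sum_eigenvalues
    rw [hX0] at this
    have := congrArg Complex.re this
    simpa using this.symm
  · rcases eq_or_ne i j with rfl | hij
    · simpa using hs
    · exact h _ _ (hX.eigenvectorBasis.orthonormal.1 i) (hX.eigenvectorBasis.orthonormal.1 j)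
        (hX.eigenvectorBasis.orthonormal.2 hij)

theorem isHermitian_map (N : QuantumChannel a b) {ρ ρ' : Matrix a a ℂ} (hρ : IsState ρ)
    (hρ' : IsState ρ') : (N.toLinearMap ρ - N.toLinearMap ρ').IsHermitian :=
  (N.posSemidef_map hρ.1).1.sub (N.posSemidef_map hρ'.1).1

theorem maxCausalEffect_le [DecidableEq a] [DecidableEq b] (N : QuantumChannel a b) {s : ℝ}
    (hs : 0 ≤ s) (h : ∀ (φ χ : EuclideanSpace ℂ a) (S : Matrix b b ℂ), ‖φ‖ = 1 → ‖χ‖ = 1 →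
      inner ℂ φ χ = 0 → Sᴴ = S → S * S = 1 → N.expectation S φ - N.expectation S χ ≤ 2 * s) :
    N.maxCausalEffect ≤ s := by
  refine Real.sSup_le ?_ hs
  rintro r ⟨ρ, ρ', hρ, hρ', -, rfl⟩
  refine div_le_of_le_mul₀ (traceNorm_nonneg _) hs ?_
  obtain ⟨S, hS, hS1, hST⟩ := exists_reflection_trace_eq_traceNorm (N.isHermitian_map hρ hρ')
  rw [← hST, ← map_sub]
  exact N.expectation_trace_le S hs (fun φ χ h1 h2 h3 => h φ χ S h1 h2 h3 hS hS1)
    (hρ.1.1.sub hρ'.1.1) (by rw [Matrix.trace_sub, hρ.2, hρ'.2, sub_self])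

theorem maxCausalEffect_nonneg [DecidableEq a] [DecidableEq b] (N : QuantumChannel a b) :
    0 ≤ N.maxCausalEffect := by
  refine Real.sSup_nonneg ?_
  rintro r ⟨ρ, ρ', -, -, -, rfl⟩
  exact div_nonneg (traceNorm_nonneg _) (traceNorm_nonneg _)

theorem continuous_expectation (N : QuantumChannel a b) {Z : Type*} [TopologicalSpace Z]
    {S : Z → Matrix b b ℂ} {ψ : Z → EuclideanSpace ℂ a} (hS : Continuous S) (hψ : Continuous ψ) :
    Continuous fun z => N.expectation (S z) (ψ z) := by
  have hN : Continuous N.toLinearMap := N.toLinearMap.continuous_of_finiteDimensional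
  have hp : Continuous fun z => pureState (ψ z) := by
    refine continuous_matrix fun i j => ?_
    simp only [pureState, Matrix.of_apply]
    fun_prop
  exact Complex.continuous_re.comp (hS.matrix_mul (hN.comp hp)).matrix_trace

/-- The largest difference of expectations of a reflection between two orthogonal pure inputs is
attained. -/
theorem exists_maximizer [DecidableEq b] (N : QuantumChannel a b) (ha : 2 ≤ Fintype.card a) :
    ∃ (φ χ : EuclideanSpace ℂ a) (S : Matrix b b ℂ), ‖φ‖ = 1 ∧ ‖χ‖ = 1 ∧ inner ℂ φ χ = 0 ∧
      Sᴴ = S ∧ S * S = 1 ∧ ∀ (φ' χ' : EuclideanSpace ℂ a) (S' : Matrix b b ℂ),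
        ‖φ'‖ = 1 → ‖χ'‖ = 1 → inner ℂ φ' χ' = 0 → S'ᴴ = S' → S' * S' = 1 →
        N.expectation S' φ' - N.expectation S' χ' ≤ N.expectation S φ - N.expectation S χ := by
  classical
  have hne : ({z | ‖z.1‖ = 1 ∧ ‖z.2‖ = 1 ∧ inner ℂ z.1 z.2 = 0} :
      Set (EuclideanSpace ℂ a × EuclideanSpace ℂ a)).Nonempty := by
    obtain ⟨i, j, hij⟩ := Fintype.exists_pair_of_one_lt_card (α := a) (by omega)
    refine ⟨(EuclideanSpace.single i 1, EuclideanSpace.single j 1), by simp, by simp, ?_⟩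
    rw [EuclideanSpace.inner_single_left]
    simp [hij]
  have hne' : ({S | Sᴴ = S ∧ S * S = 1} : Set (Matrix b b ℂ)).Nonempty := ⟨1, by simp, by simp⟩
  have hcont : Continuous fun z : (EuclideanSpace ℂ a × EuclideanSpace ℂ a) × Matrix b b ℂ =>
      N.expectation z.2 z.1.1 - N.expectation z.2 z.1.2 :=
    (N.continuous_expectation continuous_snd (continuous_fst.comp continuous_fst)).sub
      (N.continuous_expectation continuous_snd (continuous_snd.comp continuous_fst))
  obtain ⟨z, hz, hmax⟩ :=
    (isCompact_orthonormal_pairs.prod isCompact_reflections).exists_isMaxOn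
      (hne.prod hne') hcont.continuousOn
  refine ⟨z.1.1, z.1.2, z.2, hz.1.1, hz.1.2.1, hz.1.2.2, hz.2.1, hz.2.2, ?_⟩
  intro φ' χ' S' g1 g2 g3 g4 g5
  exact isMaxOn_iff.1 hmax ((φ', χ'), S') ⟨⟨g1, g2, g3⟩, g4, g5⟩

theorem singleUseProb_reflectionPOVM_zero [DecidableEq b] (N : QuantumChannel a b)
    {ψ : Fin 2 → EuclideanSpace ℂ a} (hψ : ∀ x, ‖ψ x‖ = 1) (S : Matrix b b ℂ) (hS : Sᴴ = S)
    (hS1 : S * S = 1) (x : Fin 2) :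
    N.singleUseProb ψ (reflectionPOVM S hS hS1) x 0 = (1 + N.expectation S (ψ x)) / 2 := by
  simp only [singleUseProb, reflectionPOVM, Matrix.cons_val_zero]
  rw [Matrix.smul_mul, add_mul, one_mul, Matrix.trace_smul, Matrix.trace_add, N.trace_preserving,
    (isState_pureState (hψ x)).2, show (1 / 2 : ℂ) = ((1 / 2 : ℝ) : ℂ) by simp, smul_eq_mul,
    Complex.re_ofReal_mul, Complex.add_re, Complex.one_re, expectation]
  ring

/-- A single use of the channel with two orthogonal pure inputs and a two-outcome measurement
conveys at least `1 - h₂((1 - CE) / 2)` bits. -/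
theorem exists_uniformMutualInfo_ge [DecidableEq a] [DecidableEq b] (N : QuantumChannel a b)
    (ha : 2 ≤ Fintype.card a) :
    ∃ (ψ : Fin 2 → EuclideanSpace ℂ a) (E : POVM (Fin 2) b), Orthonormal ℂ ψ ∧
      1 - binaryEntropy ((1 - N.maxCausalEffect) / 2) ≤
        uniformMutualInfo (N.singleUseProb ψ E) := by
  obtain ⟨φ, χ, S, h1, h2, h3, hS, hS1, hmax⟩ := N.exists_maximizer ha
  have hψ : ∀ x, ‖![φ, χ] x‖ = 1 := by simp [Fin.forall_fin_two, h1, h2]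
  refine ⟨![φ, χ], reflectionPOVM S hS hS1, ⟨hψ, ?_⟩, ?_⟩
  · intro i j hij
    have h3' := inner_eq_zero_symm.1 h3
    fin_cases i <;> fin_cases j <;> simp_all
  set P := N.singleUseProb ![φ, χ] (reflectionPOVM S hS hS1)
  have hP0 : ∀ x y, 0 ≤ P x y := N.singleUseProb_nonneg _ _
  have hP1 : ∀ x, ∑ y, P x y = 1 := N.sum_singleUseProb hψ _
  have hP : ∀ x, P x 0 = (1 + N.expectation S (![φ, χ] x)) / 2 :=
    N.singleUseProb_reflectionPOVM_zero hψ S hS hS1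
  have hs : N.expectation S φ - N.expectation S χ = 2 * (P 0 0 - P 1 0) := by
    rw [hP, hP]
    simp only [Matrix.cons_val_zero, Matrix.cons_val_one]
    ring
  rw [hs] at hmax
  -- Swapping φ and χ negates the difference, so the maximum is nonnegative.
  have hs0 : 0 ≤ P 0 0 - P 1 0 := by
    have := hmax χ φ S h2 h1 (inner_eq_zero_symm.1 h3) hS hS1
    linarith
  have hs1 : P 0 0 - P 1 0 ≤ 1 := by
    have := hP1 0
    rw [Fin.sum_univ_two] at this
    linarith [hP0 0 1, hP0 1 0]
  refine le_trans ?_ (one_sub_binaryEntropy_le_uniformMutualInfo hP0 hP1)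
  linarith [binaryEntropy_anti N.maxCausalEffect_nonneg (N.maxCausalEffect_le hs0 hmax) hs1]

/-- A matrix of size at most one is determined by its trace, so no two distinct states exist and the
supremum is over the empty set. -/
theorem maxCausalEffect_of_subsingleton [DecidableEq a] [DecidableEq b] [Subsingleton a]
    (N : QuantumChannel a b) : N.maxCausalEffect = 0 := by
  have : {r : ℝ | ∃ ρ ρ' : Matrix a a ℂ, IsState ρ ∧ IsState ρ' ∧ ρ ≠ ρ' ∧
      r = traceNorm (N.toLinearMap ρ - N.toLinearMap ρ') / traceNorm (ρ - ρ')} = ∅ := by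
    refine Set.eq_empty_of_forall_notMem ?_
    rintro r ⟨ρ, ρ', hρ, hρ', hne, -⟩
    refine hne (Matrix.ext fun i j => ?_)
    have hi : ∀ σ : Matrix a a ℂ, σ.trace = σ i i := fun σ =>
      Fintype.sum_subsingleton _ i
    rw [Subsingleton.elim j i, ← hi ρ, ← hi ρ', hρ.2, hρ'.2]
  rw [maxCausalEffect, this, Real.sSup_empty]

/-- Sending the same vector for both bits gives error 1/2, where the Fano bound reads I ≥ 0. An
achievable rate must be exhibited, since an empty supremum in `EReal` is `⊥`. -/
theorem zero_le_classicalCapacity [DecidableEq a] [DecidableEq b] [Nonempty a]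
    (N : QuantumChannel a b) : 0 ≤ N.classicalCapacity := by
  have i := Classical.arbitrary a
  have hψ : ∀ x : Fin 2, ‖(fun _ => EuclideanSpace.single i 1 : Fin 2 → EuclideanSpace ℂ a) x‖ = 1 :=
    by simp
  refine le_trans ?_ (N.uniformMutualInfo_le_classicalCapacity hψ
    (reflectionPOVM 1 (by simp) (by simp)))
  rw [EReal.coe_nonneg]
  refine le_trans ?_ (one_sub_binaryEntropy_le_uniformMutualInfo (N.singleUseProb_nonneg _ _)
    (N.sum_singleUseProb hψ _))
  rw [N.singleUseProb_reflectionPOVM_zero hψ, N.singleUseProb_reflectionPOVM_zero hψ, sub_self,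
    binaryEntropy_eq_binEntropy_div, sub_zero, one_div, Real.binEntropy_two_inv,
    div_self (Real.log_pos one_lt_two).ne', sub_self]

end QuantumChannel

end QuantumCapacity

theorem mainTheorem6 {a b : Type*} [Fintype a] [DecidableEq a] [Nonempty a]
    [Fintype b] [DecidableEq b] (N : QuantumCapacity.QuantumChannel a b) :
    ((1 - QuantumCapacity.binaryEntropy ((1 - N.maxCausalEffect) / 2) : ℝ) : EReal)
        ≤ N.classicalCapacity ∧
    (2 ≤ Fintype.card a →
      ∃ (ψ : Fin 2 → EuclideanSpace ℂ a) (E : QuantumCapacity.POVM (Fin 2) b),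
        Orthonormal ℂ ψ ∧
        1 - QuantumCapacity.binaryEntropy ((1 - N.maxCausalEffect) / 2)
          ≤ QuantumCapacity.uniformMutualInfo (N.singleUseProb ψ E) ∧
        (QuantumCapacity.uniformMutualInfo (N.singleUseProb ψ E) : EReal)
          ≤ N.classicalCapacity) := by
  refine ⟨?_, fun ha => ?_⟩
  · rcases le_or_gt 2 (Fintype.card a) with ha | ha
    · obtain ⟨ψ, E, hψ, h⟩ := N.exists_uniformMutualInfo_ge ha
      exact (EReal.coe_le_coe_iff.2 h).trans (N.uniformMutualInfo_le_classicalCapacity hψ.1 E)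
    -- In dimension one the claimed bound is 1 - h₂(1/2) = 0.
    · have : Subsingleton a := Fintype.card_le_one_iff_subsingleton.1 (by omega)
      rw [N.maxCausalEffect_of_subsingleton, QuantumCapacity.binaryEntropy_eq_binEntropy_div,
        sub_zero, one_div, Real.binEntropy_two_inv, div_self (Real.log_pos one_lt_two).ne',
        sub_self]
      exact N.zero_le_classicalCapacity
  · obtain ⟨ψ, E, hψ, h⟩ := N.exists_uniformMutualInfo_ge ha
    exact ⟨ψ, E, hψ, h, N.uniformMutualInfo_le_classicalCapacity hψ.1 E⟩
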